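/- For a finite digraph $G$, a \emph{multipath} of $G$ is a spanning subgraph each of whose connected components is a single vertex or a simple directed path; the \emph{multipath complex} $X(G)$ is the simplicial complex whose vertices are edges of $G$ and whose simplices are the non-empty edge sets of multipaths of $G$. Let $I_n$ be the coherently oriented linear graph with vertices $v_0,\dots,v_n$ and the $n$ edges $(v_i,v_{i+1})$, $0\le i<n$, and let $I_n\times I_m$ be the Cartesian (box) product, i.e. the grid in which $(v_i,w_j)$ has edges to $(v_{i+1},w_j)$ and to $(v_i,w_{j+1})$ whenever these vertices exist. Let $n,m\ge 0$ be integers, not both zero. Then the geometric realization of $X(I_n\times I_m)$ satisfies: (1) if $n,m\neq 1$, or if $n=0$ or $m=0$, then $X(I_n\times I_m)$ is contractible; (2) if $m=1$ and $n\ge 1$, then $X(I_n\times I_1)\simeq S^n$; (3) if $n=1$ and $m\ge 1$, then $X(I_1\times I_m)\simeq S^m$. -/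

import Mathlib

namespace MultipathComplex

/-- The coherently oriented linear graph `I_n`: vertices `v_0, …, v_n` and the `n` edges
`(v_i, v_{i+1})`. -/
def coherentLinear (n : ℕ) : Digraph (Fin (n + 1)) where
  Adj i j := (i : ℕ) + 1 = j

/-- The (Cartesian, or box) product of digraphs: move along an edge in one coordinate while the
other coordinate is fixed. For two linear graphs this is the grid. -/
def gridProd {V W : Type*} (G : Digraph V) (H : Digraph W) : Digraph (V × W) where
  Adj x y := (G.Adj x.1 y.1 ∧ x.2 = y.2) ∨ (x.1 = y.1 ∧ H.Adj x.2 y.2)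

/-- `H` is a multipath of `G`: a spanning subgraph of `G` each of whose connected components is
a single vertex or a simple path, i.e. is a copy of `I_k` for some `k ≥ 0`. Connectedness is that
of the underlying undirected graph. -/
def IsMultipath {V : Type*} (G H : Digraph V) : Prop :=
  H ≤ G ∧ ∀ C : H.toSimpleGraphInclusive.ConnectedComponent,
    ∃ (k : ℕ) (p : (coherentLinear k).Adj ↪r H.Adj), Set.range p = C.supp

/-- The spanning subgraph with edge set `S`. -/
def ofEdges {V : Type*} (S : Finset (V × V)) : Digraph V where
  Adj v w := (v, w) ∈ S

/-- Auxiliary fact: in a subgraph `H'` of `H`, two vertices of a simple path of `H` that lie in the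
same component of `H'` can only be joined along the path. -/
theorem adj_of_reachable {V : Type*} {H H' : Digraph V} (hle : H' ≤ H)
    (C : H.toSimpleGraphInclusive.ConnectedComponent) {k : ℕ}
    (p : (coherentLinear k).Adj ↪r H.Adj) (hp : Set.range p = C.supp)
    (i i' : Fin (k + 1)) (hi : (i : ℕ) + 1 = i') {x y : V}
    (hxy : H'.toSimpleGraphInclusive.Reachable x y)
    {jx jy : Fin (k + 1)} (hx : p jx = x) (hy : p jy = y) (hjx : jx ≤ i) (hjy : i < jy) :
    H'.Adj (p i) (p i') := by
  by_contra hno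
  have key : ∀ j : Fin (k + 1), p j = x → j ≤ i → ∃ l, p l = y ∧ l ≤ i := by
    clear hx hy hjx hjy jx jy
    obtain ⟨w⟩ := hxy
    induction w with
    | nil => exact fun j hj hji => ⟨j, hj, hji⟩
    | @cons u v w h _ ih =>
      intro j hj hji
      have h' : u ≠ v ∧ (H'.Adj u v ∨ H'.Adj v u) := h
      have hH : H.toSimpleGraphInclusive.Adj u v :=
        Digraph.toSimpleGraphInclusive_mono hle h
      have hu : u ∈ C.supp := hp ▸ ⟨j, hj⟩
      have hv : v ∈ C.supp := by
        rw [SimpleGraph.ConnectedComponent.mem_supp_iff] at hu ⊢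
        rw [← hu]
        exact (SimpleGraph.ConnectedComponent.sound hH.reachable).symm
      rw [← hp] at hv
      obtain ⟨l, hl⟩ := hv
      refine ih l hl ?_
      rcases h'.2 with h1 | h1
      · have h2 : (coherentLinear k).Adj j l := by
          rw [← p.map_rel_iff, hj, hl]; exact hle h1
        have h3 : (j : ℕ) + 1 = l := h2
        by_contra hli
        have hji' : j = i := by
          apply Fin.ext
          have : (j : ℕ) ≤ i := hji
          have : (i : ℕ) < l := not_le.1 hli
          omega
        have hli' : l = i' := by
          apply Fin.ext
          rw [← hi, ← h3, hji']
        apply hno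
        rw [← hji', ← hli', hj, hl]
        exact h1
      · have h2 : (coherentLinear k).Adj l j := by
          rw [← p.map_rel_iff, hj, hl]; exact hle h1
        have h3 : (l : ℕ) + 1 = j := h2
        have : (j : ℕ) ≤ i := hji
        show (l : ℕ) ≤ i
        omega
  obtain ⟨l, hl, hli⟩ := key jx hx hjx
  have : l = jy := p.injective (hl.trans hy.symm)
  subst this
  exact absurd hli (not_le.2 hjy)

/-- Being a multipath is a monotone property. -/
theorem IsMultipath.anti {V : Type*} {G H H' : Digraph V} (hH : IsMultipath G H) (hle : H' ≤ H) :
    IsMultipath G H' := by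
  classical
  refine ⟨hle.trans hH.1, fun C' => ?_⟩
  obtain ⟨v, rfl⟩ := C'.exists_rep
  obtain ⟨k, p, hp⟩ := hH.2 (H.toSimpleGraphInclusive.connectedComponentMk v)
  have hsub : ∀ w, H'.toSimpleGraphInclusive.Reachable w v → ∃ j, p j = w := by
    intro w hw
    have : w ∈ (H.toSimpleGraphInclusive.connectedComponentMk v).supp :=
      SimpleGraph.ConnectedComponent.sound
        (hw.mono (Digraph.toSimpleGraphInclusive_mono hle))
    rw [← hp] at this
    exact this
  let T : Finset (Fin (k + 1)) :=
    Finset.univ.filter fun j => H'.toSimpleGraphInclusive.Reachable (p j) v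
  have hT : ∀ j, j ∈ T ↔ H'.toSimpleGraphInclusive.Reachable (p j) v := by simp [T]
  have hne : T.Nonempty := by
    obtain ⟨j, hj⟩ := hsub v (SimpleGraph.Reachable.refl v)
    exact ⟨j, by rw [hT, hj]⟩
  obtain ⟨a, ha, hamin⟩ : ∃ a ∈ T, ∀ j ∈ T, a ≤ j := ⟨T.min' hne, T.min'_mem hne, T.min'_le⟩
  obtain ⟨b, hb, hbmax⟩ : ∃ b ∈ T, ∀ j ∈ T, j ≤ b := ⟨T.max' hne, T.max'_mem hne, T.le_max'⟩
  have hab : (a : ℕ) ≤ b := hamin b hb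
  have hab' : H'.toSimpleGraphInclusive.Reachable (p a) (p b) :=
    ((hT a).1 ha).trans ((hT b).1 hb).symm
  have hstep : ∀ i i' : Fin (k + 1), (i : ℕ) + 1 = i' → a ≤ i → i' ≤ b → H'.Adj (p i) (p i') := by
    intro i i' hi hai hib
    refine adj_of_reachable hle _ p hp i i' hi hab' rfl rfl hai ?_
    have : (i' : ℕ) ≤ b := hib
    show (i : ℕ) < b
    omega
  have hlt : ∀ j : Fin ((b : ℕ) - a + 1), (a : ℕ) + j < k + 1 := by
    intro j
    have := j.2
    have := b.2
    omega
  let q : Fin ((b : ℕ) - a + 1) → V := fun j => p ⟨a + j, hlt j⟩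
  have hq : ∀ j, H'.toSimpleGraphInclusive.Reachable (q j) v := by
    rintro ⟨j, hj⟩
    induction j with
    | zero => exact (hT a).1 ha
    | succ j ih =>
      have hj' : j < (b : ℕ) - a + 1 := by omega
      refine SimpleGraph.Reachable.trans (SimpleGraph.Adj.reachable ?_) (ih hj')
      have h1 : H'.Adj (q ⟨j, hj'⟩) (q ⟨j + 1, hj⟩) := by
        refine hstep _ _ ?_ ?_ ?_
        · simp only; omega
        · show (a : ℕ) ≤ a + j
          omega
        · show (a : ℕ) + (j + 1) ≤ b
          omega
      refine ⟨fun h => ?_, Or.inr h1⟩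
      have := congrArg Fin.val (p.injective h)
      simp only at this
      omega
  refine ⟨(b : ℕ) - a, ⟨⟨q, fun i j h => ?_⟩, ?_⟩, ?_⟩
  · have := congrArg Fin.val (p.injective h)
    apply Fin.ext
    simp only at this
    omega
  · intro i j
    constructor
    · intro h
      have h1 : H.Adj (p ⟨a + i, hlt i⟩) (p ⟨a + j, hlt j⟩) := hle h
      have h2 : (a : ℕ) + i + 1 = a + j := p.map_rel_iff.1 h1
      show (i : ℕ) + 1 = j
      omega
    · intro h
      have h2 : (i : ℕ) + 1 = j := h
      refine hstep _ _ ?_ ?_ ?_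
      · simp only; omega
      · show (a : ℕ) ≤ a + i
        omega
      · show (a : ℕ) + j ≤ b
        have := j.2
        omega
  · ext w
    constructor
    · rintro ⟨j, rfl⟩
      exact SimpleGraph.ConnectedComponent.sound (hq j)
    · intro hw
      have hw' : H'.toSimpleGraphInclusive.Reachable w v := SimpleGraph.ConnectedComponent.exact hw
      obtain ⟨j, rfl⟩ := hsub w hw'
      have h1 : (a : ℕ) ≤ j := hamin j ((hT j).2 hw')
      have h2 : (j : ℕ) ≤ b := hbmax j ((hT j).2 hw')
      refine ⟨⟨j - a, by omega⟩, ?_⟩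
      show p _ = p j
      congr 1
      apply Fin.ext
      show (a : ℕ) + (j - a) = j
      omega

/-- The multipath complex `X(G)`: its nonempty faces are the edge sets of the multipaths of `G`
that have at least one edge, so its vertices are edges of `G`. -/
def multipathComplex {V : Type*} (G : Digraph V) : PreAbstractSimplicialComplex (V × V) where
  faces := {S | S.Nonempty ∧ IsMultipath G (ofEdges S)}
  isRelLowerSet_faces := fun _ hS =>
    ⟨hS.1, fun _ hTS hT => ⟨hT, hS.2.anti fun _ _ h => hTS h⟩⟩

/-- The geometric realization of a simplicial complex on a finite vertex type, in barycentric
coordinates: the points of the standard simplex whose support lies in a face, with the subspace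
topology. -/
def realization {ι : Type*} [Fintype ι] (K : PreAbstractSimplicialComplex ι) : Set (ι → ℝ) :=
  {x | x ∈ stdSimplex ℝ ι ∧ ∃ s ∈ K.faces, ∀ i, x i ≠ 0 → i ∈ s}

end MultipathComplex

open scoped ContinuousMap

/-! The grid is graded by the sum of coordinates, so it has no directed cycles, and a set of edges
is a multipath exactly when no two of its edges share a source or a target (`mem_faces_grid`). Thus
`X` is the independence complex of the conflict graph on edges. Conflicting edges start on the same
diagonal, so this graph splits into pieces indexed by diagonals and `X` is a join, though the join
is never formed.

If a factor is trivial there are no conflicts, and `X` is a simplex. If both lengths are at least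
two, the edges leaving diagonal 1 conflict along a path on four vertices. Its independence complex
is contractible, and so is `X`: one edge of this path is dominated by another, and without it the
complex is a cone (`contractible_of_dominated_of_cone`).

For the ladder, each of the `n + 1` diagonals carries one rung in conflict with one or two
horizontal edges, which are compatible with each other. Each piece is homotopy equivalent to two
points, and the join of `n + 1` copies of `S^0` is the boundary of a cross-polytope
(`nonempty_homotopyEquiv_sphere`). -/

namespace MultipathComplex

/-! ### Contiguity, cones and dominated vertices -/

section Topology

variable {ι : Type*} [Fintype ι] {K : PreAbstractSimplicialComplex ι}

/-- Two maps into a realization whose values always lie in a common face are homotopic along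
straight lines. -/
theorem homotopic_of_contiguous {X : Type*} [TopologicalSpace X] (f g : C(X, realization K))
    (h : ∀ x, ∃ s ∈ K.faces, ∀ i, (f x).1 i ≠ 0 ∨ (g x).1 i ≠ 0 → i ∈ s) : f.Homotopic g := by
  refine ⟨⟨⟨fun p => ⟨(1 - (p.1 : ℝ)) • (f p.2).1 + (p.1 : ℝ) • (g p.2).1, ?_, ?_⟩, ?_⟩, ?_, ?_⟩⟩
  · exact convex_stdSimplex ℝ ι (f p.2).2.1 (g p.2).2.1 (sub_nonneg.2 p.1.2.2) p.1.2.1 (by ring)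
  · obtain ⟨s, hs, hi⟩ := h p.2
    refine ⟨s, hs, fun i hne => hi i ?_⟩
    by_contra! h0
    simp [h0.1, h0.2] at hne
  · refine Continuous.subtype_mk ?_ _
    fun_prop
  · intro x
    ext i
    simp
  · intro x
    ext i
    simp

/-- The vertex of the realization at a vertex of the complex. -/
def vertexPoint [DecidableEq ι] (d : ι) (hd : {d} ∈ K.faces) : realization K :=
  ⟨Pi.single d 1, single_mem_stdSimplex ℝ d, {d}, hd, fun i hi => by
    by_contra h
    exact hi (Pi.single_eq_of_ne (by simpa using h) _)⟩

/-- A complex is contractible if, after removing a vertex `c` dominated by `a`, it is a cone with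
apex `d`. -/
theorem contractible_of_dominated_of_cone [DecidableEq ι] {a c d : ι} (hac : a ≠ c)
    (hd : {d} ∈ K.faces)
    (hc : ∀ s ∈ K.faces, c ∈ s → insert a s ∈ K.faces)
    (hcone : ∀ s ∈ K.faces, c ∉ s → insert d s ∈ K.faces) :
    ContractibleSpace (realization K) := by
  have hsum : ∀ x : ι → ℝ, ∑ i, (x i + x c * (Pi.single a 1 - Pi.single c 1 : ι → ℝ) i)
      = ∑ i, x i := by
    intro x
    rw [Finset.sum_add_distrib, ← Finset.mul_sum]
    simp
  -- The common face is `s` itself where `x c = 0`, and `insert a s` otherwise.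
  have hface : ∀ x : realization K, ∃ s ∈ K.faces, ∀ i, x.1 i ≠ 0 ∨
      x.1 i + x.1 c * (Pi.single a 1 - Pi.single c 1 : ι → ℝ) i ≠ 0 → i ∈ s := by
    rintro ⟨x, hx, s, hs, hxs⟩
    by_cases h0 : x c = 0
    · exact ⟨s, hs, fun i hi => hxs i (by simpa [h0] using hi)⟩
    · refine ⟨_, hc s hs (hxs c h0), fun i hi => ?_⟩
      by_contra hmem
      rw [Finset.mem_insert, not_or] at hmem
      have hic : i ≠ c := fun h => hmem.2 (h ▸ hxs c h0)
      have hxi : x i = 0 := by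
        by_contra h
        exact hmem.2 (hxs i h)
      simp [hxi, hmem.1, hic] at hi
  -- `r` moves all the mass at `c` onto `a`, so it pushes the realization into the faces that avoid
  -- `c`.
  let r : C(realization K, realization K) :=
    ⟨fun x => ⟨fun i => x.1 i + x.1 c * (Pi.single a 1 - Pi.single c 1 : ι → ℝ) i, by
      refine ⟨⟨fun i => ?_, by rw [hsum]; exact x.2.1.2⟩, ?_⟩
      · have h1 := x.2.1.1 i
        have h2 := x.2.1.1 c
        by_cases hic : i = c
        · subst hic
          simp [hac.symm]
        · by_cases hia : i = a
          · subst hia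
            simp [hic]
            positivity
          · simpa [hic, hia] using h1
      · obtain ⟨s, hs, h⟩ := hface x
        exact ⟨s, hs, fun i hi => h i (Or.inr hi)⟩⟩,
      by
        refine Continuous.subtype_mk (continuous_pi fun i => ?_) _
        exact ((continuous_apply i).comp continuous_subtype_val).add
          (((continuous_apply c).comp continuous_subtype_val).mul continuous_const)⟩
  have hrc : ∀ x, (r x).1 c = 0 := fun x => by simp [r, hac.symm]
  rw [contractible_iff_id_nullhomotopic]
  refine ⟨vertexPoint d hd, (homotopic_of_contiguous (.id _) r hface).trans
    (homotopic_of_contiguous _ _ fun x => ?_)⟩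
  obtain ⟨hx, s, hs, hxs⟩ := (r x).2
  have hne : (s.erase c).Nonempty := by
    have : ∃ i, (r x).1 i ≠ 0 := by
      by_contra! h
      have := hx.2
      simp [h] at this
    obtain ⟨i, hi⟩ := this
    exact ⟨i, Finset.mem_erase.2 ⟨fun h => hi (h ▸ hrc x), hxs i hi⟩⟩
  have hs' : s.erase c ∈ K.faces := (K.isRelLowerSet_faces hs).2 (s.erase_subset c) hne
  refine ⟨_, hcone _ hs' (Finset.notMem_erase c s), fun i hi => ?_⟩
  rw [Finset.mem_insert, Finset.mem_erase]
  by_contra! h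
  rcases hi with hi | hi
  · exact h.2 (fun h => hi (h ▸ hrc x)) (hxs i hi)
  · exact hi (Pi.single_eq_of_ne h.1 _)

/-- A cone is contractible. -/
theorem contractible_of_cone [DecidableEq ι] {d : ι} (hd : {d} ∈ K.faces)
    (hcone : ∀ s ∈ K.faces, insert d s ∈ K.faces) : ContractibleSpace (realization K) := by
  rw [contractible_iff_id_nullhomotopic]
  refine ⟨vertexPoint d hd, homotopic_of_contiguous _ _ fun x => ?_⟩
  obtain ⟨hx, s, hs, hxs⟩ := x.2
  refine ⟨_, hcone s hs, fun i hi => ?_⟩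
  rw [Finset.mem_insert]
  by_contra! h
  rcases hi with hi | hi
  · exact h.2 (hxs i hi)
  · exact hi (Pi.single_eq_of_ne h.1 _)

end Topology

/-! ### Complexes modelled on the boundary of a cross-polytope -/

section CrossPolytope

/-- The real number `1` or `-1` given by a sign. -/
def signVal (b : Bool) : ℝ := if b then 1 else -1

theorem signVal_mul_self (b : Bool) : signVal b * signVal b = 1 := by
  cases b <;> simp [signVal]

theorem eq_of_signVal_mul_pos {b b' : Bool} {y : ℝ} (h : 0 < signVal b * y)
    (h' : 0 < signVal b' * y) : b = b' := by
  cases b <;> cases b' <;> simp [signVal] at h h' ⊢ <;> linarith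

variable {ι : Type*} {n : ℕ}

/-- The coordinates in the cross-polytope of a point given by its weights: the signed mass of each
level. -/
def signedMass [Fintype ι] (lev : ι → Fin (n + 1)) (sgn : ι → Bool) (x : ι → ℝ)
    (d : Fin (n + 1)) : ℝ :=
  ∑ e, if lev e = d then signVal (sgn e) * x e else 0

/-- The weights on representatives of the points of the cross-polytope. -/
def repWeights [DecidableEq ι] (rep : Fin (n + 1) → Bool → ι) (y : Fin (n + 1) → ℝ) (e : ι) : ℝ :=
  ∑ p : Fin (n + 1) × Bool, if rep p.1 p.2 = e then max (signVal p.2 * y p.1) 0 else 0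

theorem repWeights_nonneg [DecidableEq ι] (rep : Fin (n + 1) → Bool → ι) (y : Fin (n + 1) → ℝ)
    (e : ι) : 0 ≤ repWeights rep y e :=
  Finset.sum_nonneg fun p _ => by split_ifs <;> simp

theorem exists_of_repWeights_ne_zero [DecidableEq ι] {rep : Fin (n + 1) → Bool → ι}
    {y : Fin (n + 1) → ℝ} {e : ι} (h : repWeights rep y e ≠ 0) :
    ∃ d b, rep d b = e ∧ 0 < signVal b * y d := by
  obtain ⟨p, _, hp⟩ := Finset.exists_ne_zero_of_sum_ne_zero h
  split_ifs at hp with h1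
  · refine ⟨p.1, p.2, h1, ?_⟩
    by_contra! h2
    exact hp (max_eq_right h2)
  · exact absurd rfl hp

/-- A positive sum has a positive term. Hence the signs seen in the cross-polytope already occur in
the support of `x`. -/
theorem exists_of_signVal_mul_signedMass_pos [Fintype ι] {lev : ι → Fin (n + 1)} {sgn : ι → Bool}
    {x : ι → ℝ} (hx : ∀ e, 0 ≤ x e) {d : Fin (n + 1)} {b : Bool}
    (h : 0 < signVal b * signedMass lev sgn x d) : ∃ e, lev e = d ∧ sgn e = b ∧ x e ≠ 0 := by
  rw [signedMass, Finset.mul_sum] at h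
  obtain ⟨e, _, he⟩ := Finset.exists_lt_of_sum_lt (s := Finset.univ) (f := fun _ : ι => (0 : ℝ))
    (by simpa using h)
  split_ifs at he with h1
  · have h0 : x e ≠ 0 := fun h0 => by simp [h0] at he
    have hpos : 0 < x e := lt_of_le_of_ne (hx e) h0.symm
    refine ⟨e, h1, eq_of_signVal_mul_pos (y := signVal b) ?_ ?_, h0⟩
    · rw [← mul_assoc] at he
      rw [mul_comm]
      exact pos_of_mul_pos_left he hpos.le
    · rw [signVal_mul_self]
      exact one_pos
  · simp at he

/-- Weights of one sign cannot cancel. On a face the level determines the sign, so radial projection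
to the sphere is defined. -/
theorem signedMass_ne_zero [Fintype ι] {lev : ι → Fin (n + 1)} {sgn : ι → Bool}
    {x : ι → ℝ} (hx : ∀ e, 0 ≤ x e) {e₀ : ι} (h₀ : x e₀ ≠ 0)
    (h : ∀ e, x e ≠ 0 → lev e = lev e₀ → sgn e = sgn e₀) :
    signedMass lev sgn x (lev e₀) ≠ 0 := by
  have : 0 < signVal (sgn e₀) * signedMass lev sgn x (lev e₀) := by
    rw [signedMass, Finset.mul_sum]
    refine Finset.sum_pos' (fun e _ => ?_) ⟨e₀, Finset.mem_univ _, ?_⟩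
    · split_ifs with h1
      · by_cases h2 : x e = 0
        · simp [h2]
        · rw [h e h2 h1, ← mul_assoc, signVal_mul_self, one_mul]
          exact hx e
      · simp
    · rw [if_pos rfl, ← mul_assoc, signVal_mul_self, one_mul]
      exact lt_of_le_of_ne (hx _) h₀.symm
  intro h0
  simp [h0] at this

theorem sum_repWeights [Fintype ι] [DecidableEq ι] (rep : Fin (n + 1) → Bool → ι)
    (y : Fin (n + 1) → ℝ) : ∑ e, repWeights rep y e = ∑ d, |y d| := by
  simp only [repWeights]
  rw [Finset.sum_comm]
  simp only [Finset.sum_ite_eq, Finset.mem_univ, if_true]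
  rw [Fintype.sum_prod_type]
  refine Finset.sum_congr rfl fun d _ => ?_
  rcases le_total 0 (y d) with h | h <;> simp [signVal, h, abs_of_nonneg, abs_of_nonpos]

theorem signedMass_repWeights [Fintype ι] [DecidableEq ι] {lev : ι → Fin (n + 1)}
    {sgn : ι → Bool} {rep : Fin (n + 1) → Bool → ι} (hlev : ∀ d b, lev (rep d b) = d)
    (hsgn : ∀ d b, sgn (rep d b) = b) (y : Fin (n + 1) → ℝ) :
    signedMass lev sgn (repWeights rep y) = y := by
  funext d
  have h1 : ∀ e, (if lev e = d then signVal (sgn e) * repWeights rep y e else 0) =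
      ∑ p : Fin (n + 1) × Bool, if rep p.1 p.2 = e then
        if p.1 = d then signVal p.2 * max (signVal p.2 * y p.1) 0 else 0 else 0 := by
    intro e
    rw [repWeights, Finset.mul_sum]
    split_ifs with h
    · refine Finset.sum_congr rfl fun p _ => ?_
      split_ifs with h2 h3
      · rw [← h2, hsgn]
      · exact absurd (by rw [← h, ← h2, hlev]) h3
      · simp
    · refine (Finset.sum_eq_zero fun p _ => ?_).symm
      split_ifs with h2 h3
      · exact absurd (by rw [← h2, hlev, h3]) h
      · rfl
      · rfl
  simp only [signedMass, h1]
  rw [Finset.sum_comm]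
  simp only [Finset.sum_ite_eq, Finset.mem_univ, if_true]
  rw [Fintype.sum_prod_type]
  rw [Finset.sum_eq_single d (fun d' _ h => by simp [h]) (by simp)]
  rcases le_total 0 (y d) with h | h <;> simp [signVal, h]

theorem signedMass_smul [Fintype ι] (lev : ι → Fin (n + 1)) (sgn : ι → Bool) (c : ℝ) (x : ι → ℝ) :
    signedMass lev sgn (c • x) = c • signedMass lev sgn x := by
  funext d
  simp only [signedMass, Pi.smul_apply, smul_eq_mul, Finset.mul_sum]
  refine Finset.sum_congr rfl fun e _ => ?_
  split_ifs
  · ring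
  · simp

theorem continuous_signedMass [Fintype ι] (lev : ι → Fin (n + 1)) (sgn : ι → Bool) :
    Continuous (signedMass lev sgn) := by
  refine continuous_pi fun d => continuous_finsetSum _ fun e _ => ?_
  split_ifs <;> fun_prop

theorem continuous_repWeights [DecidableEq ι] (rep : Fin (n + 1) → Bool → ι) :
    Continuous (repWeights rep) := by
  refine continuous_pi fun d => continuous_finsetSum _ fun e _ => ?_
  split_ifs <;> fun_prop

/-- If the vertices of a complex carry one of `n + 1` levels and a sign, all combinations occur, and
the faces are the nonempty sets in which the level determines the sign, then the complex is homotopy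
equivalent to the boundary of a cross-polytope, and so to a sphere. -/
theorem nonempty_homotopyEquiv_sphere [Fintype ι] {K : PreAbstractSimplicialComplex ι}
    (E : ι → Prop) (lev : ι → Fin (n + 1)) (sgn : ι → Bool) (rep : Fin (n + 1) → Bool → ι)
    (hE : ∀ d b, E (rep d b)) (hlev : ∀ d b, lev (rep d b) = d) (hsgn : ∀ d b, sgn (rep d b) = b)
    (hK : ∀ s, s ∈ K.faces ↔ s.Nonempty ∧ (∀ e ∈ s, E e) ∧
      ∀ e ∈ s, ∀ e' ∈ s, lev e = lev e' → sgn e = sgn e') :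
    Nonempty (realization K ≃ₕ Metric.sphere (0 : EuclideanSpace ℝ (Fin (n + 1))) 1) := by
  classical
  let F : realization K → EuclideanSpace ℝ (Fin (n + 1)) := fun x =>
    WithLp.toLp 2 (signedMass lev sgn x.1)
  have hF : Continuous F := (PiLp.continuous_toLp 2 _).comp
    ((continuous_signedMass lev sgn).comp continuous_subtype_val)
  have hF0 : ∀ x, F x ≠ 0 := by
    rintro ⟨x, hx, s, hs, hxs⟩ h0
    have : ∃ e, x e ≠ 0 := by
      by_contra! h
      simpa [h] using hx.2
    obtain ⟨e, he⟩ := this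
    refine signedMass_ne_zero (lev := lev) (sgn := sgn) hx.1 he (fun e' he' hl =>
      ((hK s).1 hs).2.2 _ (hxs e' he') _ (hxs e he) hl) ?_
    exact congrArg (fun v : EuclideanSpace ℝ (Fin (n + 1)) => v (lev e)) h0
  let f : C(realization K, Metric.sphere (0 : EuclideanSpace ℝ (Fin (n + 1))) 1) :=
    ⟨fun x => ⟨‖F x‖⁻¹ • F x, by simp [norm_smul, hF0 x]⟩,
      by
        have h : Continuous fun x => ‖F x‖⁻¹ :=
          hF.norm.inv₀ fun x => norm_ne_zero_iff.2 (hF0 x)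
        exact Continuous.subtype_mk (h.smul hF) _⟩
  have hy0 : ∀ y : Metric.sphere (0 : EuclideanSpace ℝ (Fin (n + 1))) 1, ∃ d, y.1 d ≠ 0 := by
    intro y
    by_contra! h
    have h1 : y.1 = 0 := by
      ext d
      exact h d
    simpa [h1] using y.2
  have hN : ∀ y : Metric.sphere (0 : EuclideanSpace ℝ (Fin (n + 1))) 1, 0 < ∑ d, |y.1 d| := by
    intro y
    obtain ⟨d, hd⟩ := hy0 y
    exact Finset.sum_pos' (fun _ _ => abs_nonneg _) ⟨d, Finset.mem_univ _, abs_pos.2 hd⟩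
  -- The representatives carry total mass `∑ d, |y d|`, so the inverse map normalizes by the ℓ¹
  -- norm.
  have hg : ∀ y : Metric.sphere (0 : EuclideanSpace ℝ (Fin (n + 1))) 1,
      ((∑ d, |y.1 d|)⁻¹ • repWeights rep y.1) ∈ realization K := by
    intro y
    refine ⟨⟨fun e => mul_nonneg (inv_nonneg.2 (hN y).le) (repWeights_nonneg _ _ _), ?_⟩,
      Finset.univ.filter fun e => ∃ d b, rep d b = e ∧ 0 < signVal b * y.1 d, ?_, ?_⟩
    · simp only [Pi.smul_apply, smul_eq_mul]
      rw [← Finset.mul_sum, sum_repWeights]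
      exact inv_mul_cancel₀ (hN y).ne'
    · rw [hK]
      refine ⟨?_, ?_, ?_⟩
      · obtain ⟨d, hd⟩ := hy0 y
        rcases lt_or_gt_of_ne hd with h | h
        · exact ⟨rep d false, Finset.mem_filter.2
            ⟨Finset.mem_univ _, d, false, rfl, by simpa [signVal] using h⟩⟩
        · exact ⟨rep d true, Finset.mem_filter.2
            ⟨Finset.mem_univ _, d, true, rfl, by simpa [signVal] using h⟩⟩
      · intro e he
        obtain ⟨d, b, rfl, -⟩ := (Finset.mem_filter.1 he).2
        exact hE d b
      · intro e he e' he' hl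
        obtain ⟨d, b, rfl, h⟩ := (Finset.mem_filter.1 he).2
        obtain ⟨d', b', rfl, h'⟩ := (Finset.mem_filter.1 he').2
        rw [hlev, hlev] at hl
        subst hl
        rw [hsgn, hsgn]
        exact eq_of_signVal_mul_pos h h'
    · intro e he
      exact Finset.mem_filter.2 ⟨Finset.mem_univ _,
        exists_of_repWeights_ne_zero (right_ne_zero_of_mul he)⟩
  let g : C(Metric.sphere (0 : EuclideanSpace ℝ (Fin (n + 1))) 1, realization K) :=
    ⟨fun y => ⟨_, hg y⟩, by
      refine Continuous.subtype_mk (Continuous.smul (Continuous.inv₀ ?_ fun y => (hN y).ne') ?_) _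
      · fun_prop
      · exact (continuous_repWeights rep).comp
          ((PiLp.continuous_ofLp 2 _).comp continuous_subtype_val)⟩
  refine ⟨⟨f, g, homotopic_of_contiguous _ _ fun x => ?_, ?_⟩⟩
  · obtain ⟨hx, s, hs, hxs⟩ := x.2
    obtain ⟨hs1, hs2, hs3⟩ := (hK s).1 hs
    -- All vertices with the level and sign of some element of `s` still form a face; it contains
    -- the supports of both `x` and `g (f x)`.
    refine ⟨Finset.univ.filter fun e => E e ∧ ∃ e' ∈ s, lev e' = lev e ∧ sgn e' = sgn e, ?_, ?_⟩
    · rw [hK]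
      refine ⟨?_, fun e he => (Finset.mem_filter.1 he).2.1, fun e he e' he' hl => ?_⟩
      · obtain ⟨e, he⟩ := hs1
        exact ⟨e, by simpa using ⟨hs2 e he, e, he, rfl, rfl⟩⟩
      · obtain ⟨-, a, ha, hal, has⟩ := (Finset.mem_filter.1 he).2
        obtain ⟨-, a', ha', hal', has'⟩ := (Finset.mem_filter.1 he').2
        rw [← has, ← has']
        exact hs3 a ha a' ha' (by rw [hal, hal', hl])
    · intro e he
      rw [Finset.mem_filter]
      refine ⟨Finset.mem_univ _, ?_⟩
      rcases he with he | he
      · obtain ⟨d, b, rfl, hpos⟩ := exists_of_repWeights_ne_zero (right_ne_zero_of_mul he)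
        have hpos' : 0 < signVal b * (‖F x‖⁻¹ * signedMass lev sgn x.1 d) := hpos
        rw [mul_left_comm] at hpos'
        obtain ⟨e', h1, h2, h3⟩ := exists_of_signVal_mul_signedMass_pos hx.1
          (pos_of_mul_pos_right hpos' (inv_nonneg.2 (norm_nonneg _)))
        exact ⟨hE d b, e', hxs e' h3, by rw [h1, hlev], by rw [h2, hsgn]⟩
      · exact ⟨hs2 e (hxs e he), e, hxs e he, rfl, rfl⟩
  -- This composite is the identity on the nose: `g y` has signed mass proportional to `y`, and the
  -- norm is divided out.
  · have : f.comp g = ContinuousMap.id _ := by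
      ext1 y
      apply Subtype.ext
      have h1 : F (g y) = (∑ d, |y.1 d|)⁻¹ • y.1 := by
        ext d
        show signedMass lev sgn ((∑ d, |y.1 d|)⁻¹ • repWeights rep y.1) d = _
        rw [signedMass_smul, signedMass_repWeights hlev hsgn]
        rfl
      have h2 : ‖y.1‖ = 1 := by simp
      show ‖F (g y)‖⁻¹ • F (g y) = y.1
      rw [h1, norm_smul, h2, Real.norm_of_nonneg (inv_nonneg.2 (hN y).le), mul_one, inv_inv,
        smul_smul, mul_inv_cancel₀ (hN y).ne', one_smul]
    rw [this]

end CrossPolytope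

/-! ### Multipaths of a graded digraph as sets of edges without conflicts -/

section Faces

variable {V : Type*}

/-- Edges of a multipath with the same source, or with the same target, coincide. -/
theorem IsMultipath.unique {G H : Digraph V} (h : IsMultipath G H) {u v u' v' : V}
    (h1 : H.Adj u v) (h2 : H.Adj u' v') (huv : u = u' ∨ v = v') : u = u' ∧ v = v' := by
  have key : ∀ {x y : V}, H.Adj x y → ∀ {k : ℕ} (p : (coherentLinear k).Adj ↪r H.Adj)
      (C : H.toSimpleGraphInclusive.ConnectedComponent), Set.range p = C.supp →
      (x ∈ C.supp ↔ y ∈ C.supp) := by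
    intro x y hxy k p C _
    by_cases hne : x = y
    · rw [hne]
    · exact C.mem_supp_congr_adj ⟨hne, Or.inl hxy⟩
  rcases huv with rfl | rfl
  · obtain ⟨k, p, hp⟩ := h.2 (H.toSimpleGraphInclusive.connectedComponentMk u)
    have hu : u ∈ Set.range p := by rw [hp]; exact rfl
    have hv : v ∈ Set.range p := by rw [hp, ← key h1 p _ hp]; exact rfl
    have hv' : v' ∈ Set.range p := by rw [hp, ← key h2 p _ hp]; exact rfl
    obtain ⟨i, rfl⟩ := hu
    obtain ⟨j, rfl⟩ := hv
    obtain ⟨j', rfl⟩ := hv'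
    have e1 : (i : ℕ) + 1 = j := p.map_rel_iff.1 h1
    have e2 : (i : ℕ) + 1 = j' := p.map_rel_iff.1 h2
    exact ⟨rfl, congrArg p (Fin.ext (e1.symm.trans e2))⟩
  · obtain ⟨k, p, hp⟩ := h.2 (H.toSimpleGraphInclusive.connectedComponentMk v)
    have hv : v ∈ Set.range p := by rw [hp]; exact rfl
    have hu : u ∈ Set.range p := by rw [hp, key h1 p _ hp]; exact rfl
    have hu' : u' ∈ Set.range p := by rw [hp, key h2 p _ hp]; exact rfl
    obtain ⟨i, rfl⟩ := hv
    obtain ⟨j, rfl⟩ := hu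
    obtain ⟨j', rfl⟩ := hu'
    have e1 : (j : ℕ) + 1 = i := p.map_rel_iff.1 h1
    have e2 : (j' : ℕ) + 1 = i := p.map_rel_iff.1 h2
    exact ⟨congrArg p (Fin.ext (by omega)), rfl⟩

/-- A graded subgraph in which every vertex has at most one outgoing and at most one incoming edge
is a multipath. -/
theorem isMultipath_of_unique [Finite V] {G H : Digraph V} (hle : H ≤ G) (rank : V → ℕ)
    (hrank : ∀ {u v}, H.Adj u v → rank u + 1 = rank v)
    (hout : ∀ {u v v'}, H.Adj u v → H.Adj u v' → v = v')
    (hin : ∀ {u u' v}, H.Adj u v → H.Adj u' v → u = u') : IsMultipath G H := by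
  classical
  have hmono : ∀ {u v}, Relation.ReflTransGen H.Adj u v → rank u ≤ rank v ∧
      (rank u = rank v → u = v) := by
    intro u v h
    induction h with
    | refl => exact ⟨le_rfl, fun _ => rfl⟩
    | tail _ h ih =>
      have := hrank h
      exact ⟨by omega, fun _ => by omega⟩
  -- Without branching or merging, an undirected walk folds back onto itself at each turn, so its
  -- ends are joined by a directed path.
  have hchain : ∀ {u v}, H.toSimpleGraphInclusive.Reachable u v →
      Relation.ReflTransGen H.Adj u v ∨ Relation.ReflTransGen H.Adj v u := by
    rintro u v ⟨w⟩
    induction w with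
    | nil => exact Or.inl .refl
    | @cons u x v h _ ih =>
      have h' : u ≠ x ∧ (H.Adj u x ∨ H.Adj x u) := h
      rcases h'.2 with h1 | h1 <;> rcases ih with h2 | h2
      · exact Or.inl (.head h1 h2)
      · rcases h2.cases_tail with rfl | ⟨y, hy, hyx⟩
        · exact Or.inl (.single h1)
        · rw [hin h1 hyx]
          exact Or.inr hy
      · rcases h2.cases_head with rfl | ⟨y, hxy, hy⟩
        · exact Or.inr (.single h1)
        · rw [hout h1 hxy]
          exact Or.inl hy
      · exact Or.inr (.tail h2 h1)
  have hreach : ∀ {u v}, Relation.ReflTransGen H.Adj u v →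
      H.toSimpleGraphInclusive.Reachable u v := by
    intro u v h
    induction h with
    | refl => exact .refl _
    | tail _ h ih =>
      refine ih.trans (SimpleGraph.Adj.reachable ⟨fun he => ?_, Or.inl h⟩)
      have := hrank h
      rw [he] at this
      omega
  have hstep : ∀ {u v}, Relation.ReflTransGen H.Adj u v → ∀ j ≤ rank v - rank u, ∃ w,
      Relation.ReflTransGen H.Adj u w ∧ rank w = rank u + j := by
    intro u v h
    induction h with
    | refl => exact fun j hj => ⟨u, .refl, by omega⟩
    | @tail x y hx h ih =>
      intro j hj
      have h1 := hrank h
      have h2 := (hmono hx).1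
      by_cases hj' : j ≤ rank x - rank u
      · exact ih j hj'
      · exact ⟨y, hx.tail h, by omega⟩
  refine ⟨hle, fun C => ?_⟩
  obtain ⟨a, ha, hamin⟩ := Set.exists_min_image C.supp rank (Set.toFinite _) C.nonempty_supp
  obtain ⟨b, hb, hbmax⟩ := Set.exists_max_image C.supp rank (Set.toFinite _) C.nonempty_supp
  have hfrom : ∀ w ∈ C.supp, Relation.ReflTransGen H.Adj a w := by
    intro w hw
    rcases hchain (SimpleGraph.ConnectedComponent.exact (hw.trans ha.symm)) with h | h
    · have h1 := hmono h
      rw [h1.2 (le_antisymm h1.1 (hamin w hw))]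
    · exact h
  have hinj : ∀ u ∈ C.supp, ∀ v ∈ C.supp, rank u = rank v → u = v := by
    intro u hu v hv huv
    rcases hchain (SimpleGraph.ConnectedComponent.exact (hu.trans hv.symm)) with h | h
    · exact (hmono h).2 huv
    · exact ((hmono h).2 huv.symm).symm
  have hmem : ∀ {w}, Relation.ReflTransGen H.Adj a w → w ∈ C.supp := fun h =>
    (SimpleGraph.ConnectedComponent.sound (hreach h).symm).trans ha
  -- Rank is injective on the component and takes every value between its extremes, so it
  -- parametrizes the path.
  choose p hp hprank using fun j : Fin (rank b - rank a + 1) =>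
    hstep (hfrom b hb) j (Nat.lt_succ_iff.1 j.2)
  refine ⟨rank b - rank a, ⟨⟨p, fun i j hij => ?_⟩, ?_⟩, ?_⟩
  · have h1 := hprank i
    have h2 := hprank j
    rw [hij] at h1
    exact Fin.ext (by omega)
  · intro i j
    have h1 := hprank i
    have h2 := hprank j
    constructor
    · intro h
      have : rank (p i) + 1 = rank (p j) := hrank h
      show (i : ℕ) + 1 = j
      omega
    · intro h
      have h3 : (i : ℕ) + 1 = j := h
      show H.Adj (p i) (p j)
      rcases (hp j).cases_tail with h4 | ⟨y, hy, hyj⟩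
      · rw [h4] at h2
        omega
      · have h5 := hrank hyj
        rwa [hinj (p i) (hmem (hp i)) y (hmem hy) (by omega)]
  · ext w
    constructor
    · rintro ⟨j, rfl⟩
      exact hmem (hp j)
    · intro hw
      have h1 := hamin w hw
      have h2 := hbmax w hw
      refine ⟨⟨rank w - rank a, by omega⟩, hinj _ (hmem (hp _)) _ hw ?_⟩
      show rank (p _) = _
      rw [hprank]
      simp only
      omega

/-- Faces of the multipath complex of a graded digraph. -/
theorem mem_faces_multipathComplex [Finite V] {G : Digraph V} (rank : V → ℕ)
    (hrank : ∀ {u v}, G.Adj u v → rank u + 1 = rank v) {S : Finset (V × V)} :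
    S ∈ (multipathComplex G).faces ↔ S.Nonempty ∧ (∀ e ∈ S, G.Adj e.1 e.2) ∧
      ∀ e ∈ S, ∀ e' ∈ S, e.1 = e'.1 ∨ e.2 = e'.2 → e = e' := by
  refine and_congr_right fun _ => ⟨fun h => ⟨fun e he => h.1 he, fun e he e' he' hee => ?_⟩,
    fun ⟨hE, hu⟩ => ?_⟩
  · obtain ⟨h1, h2⟩ := h.unique (u := e.1) (v := e.2) (u' := e'.1) (v' := e'.2) he he' hee
    exact Prod.ext h1 h2
  · have hle : ofEdges S ≤ G := fun u v h => hE (u, v) h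
    exact isMultipath_of_unique hle rank (fun h => hrank (hle h))
      (fun h h' => congrArg Prod.snd (hu _ h _ h' (Or.inl rfl)))
      (fun h h' => congrArg Prod.fst (hu _ h _ h' (Or.inr rfl)))

/-- Faces of the multipath complex of a grid: sets of edges no two of which share their source or
their target. -/
theorem mem_faces_grid {n m : ℕ} {S : Finset ((Fin (n + 1) × Fin (m + 1)) ×
      (Fin (n + 1) × Fin (m + 1)))} :
    S ∈ (multipathComplex (gridProd (coherentLinear n) (coherentLinear m))).faces ↔
      S.Nonempty ∧ (∀ e ∈ S, (gridProd (coherentLinear n) (coherentLinear m)).Adj e.1 e.2) ∧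
      ∀ e ∈ S, ∀ e' ∈ S, e.1 = e'.1 ∨ e.2 = e'.2 → e = e' := by
  refine mem_faces_multipathComplex (fun v => (v.1 : ℕ) + v.2) ?_
  rintro ⟨i, j⟩ ⟨i', j'⟩ (⟨h1, h2⟩ | ⟨h1, h2⟩)
  · have h1 : (i : ℕ) + 1 = i' := h1
    have h2 : j = j' := h2
    simp only [← h1, h2]
    omega
  · have h1 : i = i' := h1
    have h2 : (j : ℕ) + 1 = j' := h2
    simp only [← h2, h1]
    omega

end Faces

/-! ### Grids and ladders -/

section Grid

theorem gridProd_coherentLinear_adj {n m : ℕ} {x y : Fin (n + 1) × Fin (m + 1)} :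
    (gridProd (coherentLinear n) (coherentLinear m)).Adj x y ↔
      ((x.1 : ℕ) + 1 = y.1 ∧ (x.2 : ℕ) = y.2) ∨ ((x.1 : ℕ) = y.1 ∧ (x.2 : ℕ) + 1 = y.2) := by
  rw [← Fin.ext_iff, ← Fin.ext_iff]
  exact Iff.rfl

/-- A grid with a trivial factor is a path, whose edges form a face. -/
theorem contractible_of_eq_zero {n m : ℕ} (hnm : (n, m) ≠ (0, 0)) (h : n = 0 ∨ m = 0) :
    ContractibleSpace (realization (multipathComplex
      (gridProd (coherentLinear n) (coherentLinear m)))) := by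
  have hface : ∀ S, S ∈ (multipathComplex (gridProd (coherentLinear n) (coherentLinear m))).faces ↔
      S.Nonempty ∧ (∀ e ∈ S, (gridProd (coherentLinear n) (coherentLinear m)).Adj e.1 e.2) := by
    intro S
    rw [mem_faces_grid]
    refine and_congr_right fun _ => and_iff_left_of_imp fun hE => ?_
    rintro ⟨⟨a, b⟩, a', b'⟩ he ⟨⟨c, d⟩, c', d'⟩ he'
    have h1 := gridProd_coherentLinear_adj.1 (hE _ he)
    have h2 := gridProd_coherentLinear_adj.1 (hE _ he')
    simp only [Prod.mk.injEq, Fin.ext_iff] at h1 h2 ⊢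
    omega
  obtain ⟨e, he⟩ : ∃ e : (Fin (n + 1) × Fin (m + 1)) × (Fin (n + 1) × Fin (m + 1)),
      (gridProd (coherentLinear n) (coherentLinear m)).Adj e.1 e.2 := by
    by_cases hn : n = 0
    · subst hn
      have hm : m ≠ 0 := fun h => hnm (by rw [h])
      exact ⟨((0, 0), (0, ⟨1, by omega⟩)), Or.inr ⟨rfl, rfl⟩⟩
    · exact ⟨((0, 0), (⟨1, by omega⟩, 0)), Or.inl ⟨rfl, rfl⟩⟩
  refine contractible_of_cone (d := e) ((hface _).2 ⟨Finset.singleton_nonempty e, ?_⟩)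
    fun s hs => (hface _).2 ⟨Finset.insert_nonempty _ _, ?_⟩
  · simpa using he
  · intro e' he'
    rcases Finset.mem_insert.1 he' with rfl | h
    · exact he
    · exact ((hface s).1 hs).2 e' h

/-- The face condition for adding an edge to a face of the complex of a grid. -/
theorem insert_mem_faces_grid {n m : ℕ} {s : Finset ((Fin (n + 1) × Fin (m + 1)) ×
      (Fin (n + 1) × Fin (m + 1)))} {a : (Fin (n + 1) × Fin (m + 1)) × (Fin (n + 1) × Fin (m + 1))}
    (hs : s ∈ (multipathComplex (gridProd (coherentLinear n) (coherentLinear m))).faces)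
    (ha : (gridProd (coherentLinear n) (coherentLinear m)).Adj a.1 a.2)
    (h : ∀ e ∈ s, e.1 = a.1 ∨ e.2 = a.2 → e = a) :
    insert a s ∈ (multipathComplex (gridProd (coherentLinear n) (coherentLinear m))).faces := by
  obtain ⟨-, hE, hu⟩ := mem_faces_grid.1 hs
  refine mem_faces_grid.2 ⟨Finset.insert_nonempty _ _, fun e he => ?_, fun e he e' he' hee => ?_⟩
  · rcases Finset.mem_insert.1 he with rfl | he
    · exact ha
    · exact hE e he
  · rcases Finset.mem_insert.1 he with h1 | h1 <;> rcases Finset.mem_insert.1 he' with h2 | h2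
    · rw [h1, h2]
    · rw [h1] at hee ⊢
      exact (h e' h2 (hee.imp Eq.symm Eq.symm)).symm
    · rw [h2] at hee ⊢
      exact h e h1 hee
    · exact hu e h1 e' h2 hee

/-- In a grid with both factors of length at least two, the edges between the first and the second
diagonal form a zigzag of four edges, which makes the complex contractible. -/
theorem contractible_of_two_le {n m : ℕ} (hn : 2 ≤ n) (hm : 2 ≤ m) :
    ContractibleSpace (realization (multipathComplex
      (gridProd (coherentLinear n) (coherentLinear m)))) := by
  let x₁ : Fin (n + 1) := ⟨1, by omega⟩
  let x₂ : Fin (n + 1) := ⟨2, by omega⟩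
  let y₁ : Fin (m + 1) := ⟨1, by omega⟩
  let y₂ : Fin (m + 1) := ⟨2, by omega⟩
  -- With `b` the edge from `(0, 1)` to `(1, 1)`, the conflicts form the path `d - c - b - a`. Only
  -- `b` conflicts with `a`, and `b` also conflicts with `c`, so `a` dominates `c`; only `c`
  -- conflicts with `d`.
  refine contractible_of_dominated_of_cone (a := ((0, y₁), (0, y₂))) (c := ((x₁, 0), (x₁, y₁)))
    (d := ((x₁, 0), (x₂, 0))) ?_ ?_ ?_ ?_
  · intro h
    simpa [x₁] using congrArg (fun e => (e.1.1 : ℕ)) h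
  · refine mem_faces_grid.2 ⟨Finset.singleton_nonempty _, ?_, ?_⟩
    · intro e he
      rw [Finset.mem_singleton.1 he]
      exact Or.inl ⟨rfl, rfl⟩
    · intro e he e' he' _
      rw [Finset.mem_singleton.1 he, Finset.mem_singleton.1 he']
  · intro s hs hc
    obtain ⟨-, hE, hu⟩ := mem_faces_grid.1 hs
    refine insert_mem_faces_grid hs (Or.inr ⟨rfl, rfl⟩) ?_
    rintro ⟨⟨a, b⟩, a', b'⟩ he
    have h1 := gridProd_coherentLinear_adj.1 (hE _ he)
    have h2 := hu _ he _ hc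
    simp only [Prod.mk.injEq, Fin.ext_iff, x₁, y₁, y₂, Fin.val_zero] at h1 h2 ⊢
    omega
  · intro s hs hc
    obtain ⟨-, hE, hu⟩ := mem_faces_grid.1 hs
    refine insert_mem_faces_grid hs (Or.inl ⟨rfl, rfl⟩) ?_
    rintro ⟨⟨a, b⟩, a', b'⟩ he
    have h1 := gridProd_coherentLinear_adj.1 (hE _ he)
    have h2 := ne_of_mem_of_not_mem he hc
    simp only [Prod.mk.injEq, Fin.ext_iff, x₁, x₂, y₁, Fin.val_zero, ne_eq] at h1 h2 ⊢
    omega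

/-- The diagonal on which an edge of the ladder starts. -/
def ladderLevel {n : ℕ} (e : (Fin (n + 1) × Fin 2) × (Fin (n + 1) × Fin 2)) : Fin (n + 1) :=
  -- The minimum matters only for pairs that are not edges, since no edge starts at `(n, 1)`.
  ⟨min (e.1.1 + e.1.2) n, by omega⟩

/-- The direction of an edge of the ladder: `true` for rungs. -/
def ladderSign {n : ℕ} (e : (Fin (n + 1) × Fin 2) × (Fin (n + 1) × Fin 2)) : Bool :=
  decide ((e.1.1 : ℕ) = e.2.1)

/-- An edge of the ladder on a given diagonal in a given direction. -/
def ladderEdge {n : ℕ} (hn : 1 ≤ n) (d : Fin (n + 1)) (b : Bool) :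
    (Fin (n + 1) × Fin 2) × (Fin (n + 1) × Fin 2) :=
  if b then ((d, 0), (d, 1)) else
    -- Diagonal 0 has no vertex in the upper row, so its horizontal edge is taken from the lower
    -- one.
    if (d : ℕ) = 0 then ((d, 0), (⟨1, by omega⟩, 0)) else ((⟨d - 1, by omega⟩, 1), (d, 1))

theorem ladderEdge_adj {n : ℕ} (hn : 1 ≤ n) (d : Fin (n + 1)) (b : Bool) :
    (gridProd (coherentLinear n) (coherentLinear 1)).Adj (ladderEdge hn d b).1
      (ladderEdge hn d b).2 := by
  rw [gridProd_coherentLinear_adj, ladderEdge]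
  split_ifs with _ h
  · simp
  · simp [h]
  · simp
    omega

theorem ladderLevel_ladderEdge {n : ℕ} (hn : 1 ≤ n) (d : Fin (n + 1)) (b : Bool) :
    ladderLevel (ladderEdge hn d b) = d := by
  rw [ladderEdge, ladderLevel, Fin.ext_iff]
  split_ifs <;> simp <;> omega

theorem ladderSign_ladderEdge {n : ℕ} (hn : 1 ≤ n) (d : Fin (n + 1)) (b : Bool) :
    ladderSign (ladderEdge hn d b) = b := by
  rw [ladderEdge, ladderSign]
  cases b
  · by_cases h : (d : ℕ) = 0
    · simp [h]
    · simp [h]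
      omega
  · simp

/-- Edges of the ladder can be in a common multipath unless they start on the same diagonal and
have different directions. -/
theorem ladder_compatible_iff {n : ℕ} {e e' : (Fin (n + 1) × Fin 2) × (Fin (n + 1) × Fin 2)}
    (h : (gridProd (coherentLinear n) (coherentLinear 1)).Adj e.1 e.2)
    (h' : (gridProd (coherentLinear n) (coherentLinear 1)).Adj e'.1 e'.2) :
    (e.1 = e'.1 ∨ e.2 = e'.2 → e = e') ↔
      (ladderLevel e = ladderLevel e' → ladderSign e = ladderSign e') := by
  obtain ⟨⟨a, b⟩, a', b'⟩ := e
  obtain ⟨⟨c, d⟩, c', d'⟩ := e'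
  rw [gridProd_coherentLinear_adj] at h h'
  simp only [Prod.mk.injEq, Fin.ext_iff, ladderLevel, ladderSign, decide_eq_decide] at h h' ⊢
  -- On a diagonal, the rung shares its source with the lower horizontal edge and its target with
  -- the upper one, whenever these exist; the two horizontal edges share neither.
  omega

theorem nonempty_homotopyEquiv_sphere_ladder {n : ℕ} (hn : 1 ≤ n) :
    Nonempty (realization (multipathComplex (gridProd (coherentLinear n) (coherentLinear 1))) ≃ₕ
      Metric.sphere (0 : EuclideanSpace ℝ (Fin (n + 1))) 1) := by
  refine nonempty_homotopyEquiv_sphere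
    (fun e => (gridProd (coherentLinear n) (coherentLinear 1)).Adj e.1 e.2) ladderLevel ladderSign
    (ladderEdge hn) (ladderEdge_adj hn) (ladderLevel_ladderEdge hn) (ladderSign_ladderEdge hn)
    fun s => ?_
  rw [mem_faces_grid]
  refine and_congr_right fun _ => and_congr_right fun hE => ?_
  exact forall₂_congr fun e he => forall₂_congr fun e' he' =>
    ladder_compatible_iff (hE e he) (hE e' he')

theorem gridProd_adj_swap {V W : Type*} {G : Digraph V} {H : Digraph W} {x y : V × W} :
    (gridProd H G).Adj x.swap y.swap ↔ (gridProd G H).Adj x y := by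
  show (_ ∧ _) ∨ (_ ∧ _) ↔ (_ ∧ _) ∨ (_ ∧ _)
  simp only [Prod.fst_swap, Prod.snd_swap]
  tauto

/-- Transposition carries this grid to the ladder. A double swap reduces definitionally, so the
facts about `ladderEdge` apply unchanged. -/
theorem nonempty_homotopyEquiv_sphere_ladder_swap {m : ℕ} (hm : 1 ≤ m) :
    Nonempty (realization (multipathComplex (gridProd (coherentLinear 1) (coherentLinear m))) ≃ₕ
      Metric.sphere (0 : EuclideanSpace ℝ (Fin (m + 1))) 1) := by
  refine nonempty_homotopyEquiv_sphere
    (fun e => (gridProd (coherentLinear 1) (coherentLinear m)).Adj e.1 e.2)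
    (fun e => ladderLevel (e.1.swap, e.2.swap)) (fun e => ladderSign (e.1.swap, e.2.swap))
    (fun d b => ((ladderEdge hm d b).1.swap, (ladderEdge hm d b).2.swap))
    (fun d b => gridProd_adj_swap.2 (ladderEdge_adj hm d b)) (ladderLevel_ladderEdge hm)
    (ladderSign_ladderEdge hm) fun s => ?_
  rw [mem_faces_grid]
  refine and_congr_right fun _ => and_congr_right fun hE => ?_
  refine forall₂_congr fun e he => forall₂_congr fun e' he' => ?_
  rw [← ladder_compatible_iff (gridProd_adj_swap.2 (hE e he)) (gridProd_adj_swap.2 (hE e' he'))]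
  simp only [Prod.swap_inj, Prod.mk.injEq, ← Prod.ext_iff]

end Grid

end MultipathComplex

theorem mainTheorem9 (n m : ℕ) :
    ((n, m) ≠ (0, 0) → ((n ≠ 1 ∧ m ≠ 1) ∨ n = 0 ∨ m = 0) →
      ContractibleSpace (MultipathComplex.realization (MultipathComplex.multipathComplex
        (MultipathComplex.gridProd (MultipathComplex.coherentLinear n)
          (MultipathComplex.coherentLinear m))))) ∧
    (m = 1 → 1 ≤ n →
      Nonempty (MultipathComplex.realization (MultipathComplex.multipathComplex
        (MultipathComplex.gridProd (MultipathComplex.coherentLinear n)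
          (MultipathComplex.coherentLinear m))) ≃ₕ
        Metric.sphere (0 : EuclideanSpace ℝ (Fin (n + 1))) 1)) ∧
    (n = 1 → 1 ≤ m →
      Nonempty (MultipathComplex.realization (MultipathComplex.multipathComplex
        (MultipathComplex.gridProd (MultipathComplex.coherentLinear n)
          (MultipathComplex.coherentLinear m))) ≃ₕ
        Metric.sphere (0 : EuclideanSpace ℝ (Fin (m + 1))) 1)) := by
  refine ⟨fun h0 h => ?_, fun hm hn => ?_, fun hn hm => ?_⟩
  · by_cases hnm : n = 0 ∨ m = 0
    · exact MultipathComplex.contractible_of_eq_zero h0 hnm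
    · exact MultipathComplex.contractible_of_two_le (by omega) (by omega)
  · subst hm
    exact MultipathComplex.nonempty_homotopyEquiv_sphere_ladder hn
  · subst hn
    exact MultipathComplex.nonempty_homotopyEquiv_sphere_ladder_swap hm
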